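/- Let $(E,d_E)$ and $(\Sigma,d_\Sigma)$ be complete separable metric spaces with their Borel $\sigma$-fields, and let $\mathcal M_1(\cdot)$ denote the set of Borel probability measures. Let $\psi:E\to[1,\infty)$ be continuous and $\mathcal M_1^\psi(E):=\{\mu\in\mathcal M_1(E):\int\psi\,d\mu<\infty\}$. For $n\in\mathbb N=\{1,2,\dots\}$ and $x_1,\dots,x_n\in E$ let $\widehat m_n(x_1,\dots,x_n):=\frac1n\sum_{i=1}^n\delta_{x_i}$. Let $\Theta\subset\mathcal M_1^\psi(E)$ contain all these empirical measures, and let $T_n:\Theta\to\Sigma$ ($n\in\mathbb N$) be maps such that the plug-in estimators $$\widehat T_n:E^{\mathbb N}\to\Sigma,\qquad \widehat T_n(x_1,x_2,\dots):=\widehat t_n(x_1,\dots,x_n):=T_n(\widehat m_n(x_1,\dots,x_n)),$$ are measurable for the product $\sigma$-field on $E^{\mathbb N}$. For $\mu\in\Theta$ let $\mathbb P^\mu:=\mu^{\otimes\mathbb N}$ (i.i.d. observations). Let $d_\Theta$ and $d_{\rm w}$ be any metrics on $\Theta$ generating the relative weak topology, put $d_\psi(\mu_1,\mu_2):=d_{\rm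 w}(\mu_1,\mu_2)+|\int\psi\,d\mu_1-\int\psi\,d\mu_2|$, let $\rho$ be any metric on $\mathcal M_1(\Sigma)$ generating the weak topology, and let $$\rho_{\rm P}(\nu_1,\nu_2):=\inf\{\varepsilon>0:\ \nu_1[A]\le\nu_2[A^\varepsilon]+\varepsilon\ \text{for all Borel } A\subset\Sigma\},\qquad A^\varepsilon:=\{s:\inf_{a\in A}d_\Sigma(s,a)\le\varepsilon\},$$ be the Prohorov metric. Let $\Theta_0\subset\Theta$ and let $r$ be a metric on $\mathcal M_1(\Sigma)$. The sequence $(\widehat T_n)$ is called *asymptotically $(d_\Theta,r)$-robust on $\Theta_0$* if for every $\mu_1\in\Theta_0$ and $\varepsilon>0$ there are $\delta>0$ and $n_0\in\mathbb N$ such that $r(\mathbb P^{\mu_1}\circ\widehat T_n^{-1},\mathbb P^{\mu_2}\circ\widehat T_n^{-1})\le\varepsilon$ for all $n\ge n_0$ and all $\mu_2\in\Theta_0$ with $d_\Theta(\mu_1,\mu_2)\le\delta$. It is called *finite-sample $(d_\Theta,r)$-robust on $\Theta_0$* if for every $\mu_1\in\Theta_0$, $\varepsilon>0$ and $n_0\in\mathbb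 N$ there is $\delta>0$ such that the same inequality holds for all $1\le n\le n_0$ and all $\mu_2\in\Theta_0$ with $d_\Theta(\mu_1,\mu_2)\le\delta$. The sequence $(T_n)$ is called *asymptotically $(d_\psi,d_\Sigma)$-continuous* if for every $\mu_1\in\Theta$ and $\varepsilon>0$ there are $\delta>0$ and $n_0\in\mathbb N$ such that $d_\Sigma(T_n(\mu_1),T_n(\mu_2))\le\varepsilon$ for all $n\ge n_0$ and all $\mu_2\in\Theta$ with $d_\psi(\mu_1,\mu_2)\le\delta$. The set $\Theta_0$ is called *locally uniformly $\psi$-integrating* if, for a metric $d_{\Theta_0}$ on $\Theta_0$ generating the relative weak topology, for every $\mu_1\in\Theta_0$ and $\varepsilon>0$ there are $\delta>0$ and $a>0$ such that $\int\psi\,\mathbf 1_{\{\psi\ge a\}}\,d\mu_2\le\varepsilon$ for all $\mu_2\in\Theta_0$ with $d_{\Theta_0}(\mu_1,\mu_2)\le\delta$. **Theorem.** The following three assertions hold. (i) If $(T_n)$ is asymptotically $(d_\psi,d_\Sigma)$-continuous, then $(\widehat T_n)$ is asymptotically $(d_\Theta,\rho_{\rm P})$-robust on every locally uniformly $\psi$-integrating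 set $\Theta_0\subset\Theta$. (ii) If $\widehat t_n:E^n\to\Sigma$ is continuous for every $n\in\mathbb N$ (with the metric $\max_{1\le i\le n} d_E(x_i,y_i)$ on $E^n$), then $(\widehat T_n)$ is finite-sample $(d_\Theta,\rho)$-robust on $\Theta$. (iii) Let $\Theta_0\subset\Theta$. If $(\widehat T_n)$ is asymptotically $(d_\Theta,\rho)$-robust on $\Theta_0$ and $T_0:\Theta_0\to\Sigma$ is a map such that $\lim_{n\to\infty}\mathbb P^\mu[d_\Sigma(\widehat T_n,T_0(\mu))\ge\eta]=0$ for all $\eta>0$ and $\mu\in\Theta_0$, then $T_0$ is $(d_\Theta,d_\Sigma)$-continuous. -/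

import Mathlib

open MeasureTheory Filter Topology
open scoped ENNReal

namespace PlugIn

noncomputable section

/-- The real-valued function `d` is a metric on `X` which generates the given topology of `X`. -/
structure Metrizes {X : Type*} [TopologicalSpace X] (d : X → X → ℝ) : Prop where
  dist_self : ∀ x, d x x = 0
  eq_of_dist_eq_zero : ∀ x y, d x y = 0 → x = y
  dist_comm : ∀ x y, d x y = d y x
  dist_triangle : ∀ x y z, d x z ≤ d x y + d y z
  isOpen_iff : ∀ s : Set X, IsOpen s ↔ ∀ x ∈ s, ∃ ε > 0, ∀ y, d x y < ε → y ∈ s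

section Model

variable {Ω Θ S : Type*} [MeasurableSpace Ω] [MeasurableSpace S]

/-- The law of the estimator `That n` under `P θ`. -/
def estLaw (P : Θ → ProbabilityMeasure Ω) (That : ℕ+ → Ω → S) (hT : ∀ n, Measurable (That n))
    (n : ℕ+) (θ : Θ) : ProbabilityMeasure S :=
  (P θ).map (hT n).aemeasurable

/-- Asymptotic `(dΘ, ρ)`-robustness of the sequence `(That n)` on `Θ₀`. -/
def AsymptoticallyRobustOn (P : Θ → ProbabilityMeasure Ω) (That : ℕ+ → Ω → S)
    (hT : ∀ n, Measurable (That n)) (dΘ : Θ → Θ → ℝ)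
    (ρ : ProbabilityMeasure S → ProbabilityMeasure S → ℝ) (Θ₀ : Set Θ) : Prop :=
  ∀ θ₁ ∈ Θ₀, ∀ ε > (0 : ℝ), ∃ δ > (0 : ℝ), ∃ n₀ : ℕ+, ∀ θ₂ ∈ Θ₀, dΘ θ₁ θ₂ ≤ δ →
    ∀ n, n₀ ≤ n → ρ (estLaw P That hT n θ₁) (estLaw P That hT n θ₂) ≤ ε

/-- Finite-sample `(dΘ, ρ)`-robustness of the sequence `(That n)` on `Θ₀`. -/
def FiniteSampleRobustOn (P : Θ → ProbabilityMeasure Ω) (That : ℕ+ → Ω → S)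
    (hT : ∀ n, Measurable (That n)) (dΘ : Θ → Θ → ℝ)
    (ρ : ProbabilityMeasure S → ProbabilityMeasure S → ℝ) (Θ₀ : Set Θ) : Prop :=
  ∀ θ₁ ∈ Θ₀, ∀ ε > (0 : ℝ), ∀ n₀ : ℕ+, ∃ δ > (0 : ℝ), ∀ θ₂ ∈ Θ₀, dΘ θ₁ θ₂ ≤ δ →
    ∀ n, n ≤ n₀ → ρ (estLaw P That hT n θ₁) (estLaw P That hT n θ₂) ≤ ε

end Model

section Continuity

variable {X Y : Type*} [MetricSpace Y]

/-- Asymptotic continuity of a sequence of maps, with respect to the distance function `d` on the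
domain and the metric of the target space. -/
def AsymptoticallyContinuous (d : X → X → ℝ) (V : ℕ+ → X → Y) : Prop :=
  ∀ u₁, ∀ ε > (0 : ℝ), ∃ δ > (0 : ℝ), ∃ n₀ : ℕ+, ∀ u₂, d u₁ u₂ ≤ δ →
    ∀ n, n₀ ≤ n → dist (V n u₁) (V n u₂) ≤ ε

/-- Continuity of a map, with respect to the distance function `d` on the domain and the metric
of the target space. -/
def ContinuousWrt (d : X → X → ℝ) (f : X → Y) : Prop :=
  ∀ u₁, ∀ ε > (0 : ℝ), ∃ δ > (0 : ℝ), ∀ u₂, d u₁ u₂ ≤ δ → dist (f u₁) (f u₂) ≤ ε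

end Continuity

/-- The Prohorov metric. Here `Metric.cthickening ε A` is the set of all points `s` with
`inf_{a ∈ A} d(s, a) ≤ ε`. -/
def prohorov {S : Type*} [MetricSpace S] [MeasurableSpace S]
    (μ₁ μ₂ : ProbabilityMeasure S) : ℝ :=
  sInf {ε : ℝ | 0 < ε ∧ ∀ A : Set S, MeasurableSet A →
    (μ₁ : Measure S) A ≤ (μ₂ : Measure S) (Metric.cthickening ε A) + ENNReal.ofReal ε}

section Sample

variable {E : Type*} [MeasurableSpace E]

/-- The empirical probability measure `(1/n) ∑ δ_{x i}` of a sample of size `n ≥ 1`. -/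
def empirical (n : ℕ+) (x : Fin n → E) : ProbabilityMeasure E :=
  ⟨((n : ℕ) : ℝ≥0∞)⁻¹ • ∑ i, Measure.dirac (x i), ⟨by
    have hn : ((n : ℕ) : ℝ≥0∞) ≠ 0 := by exact_mod_cast n.ne_zero
    simp [ENNReal.inv_mul_cancel hn (ENNReal.natCast_ne_top _)]⟩⟩

/-- The infinite product measure on the sequence space: under it, the coordinate projections are
independent and distributed according to `μ`. -/
def iidLaw (μ : ProbabilityMeasure E) : ProbabilityMeasure (ℕ → E) :=
  ⟨Measure.infinitePi fun _ : ℕ => (μ : Measure E), inferInstance⟩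

/-- The set of all probability measures which integrate `ψ`. -/
def psiMeasures (ψ : E → ℝ) : Set (ProbabilityMeasure E) :=
  {μ | Integrable ψ (μ : Measure E)}

/-- The metric `d_ψ(μ₁, μ₂) = d_w(μ₁, μ₂) + |∫ ψ dμ₁ - ∫ ψ dμ₂|` on a set `M` of probability
measures, where `dw` is a metric on `M` for the weak topology. -/
def dPsi (ψ : E → ℝ) {M : Set (ProbabilityMeasure E)} (dw : M → M → ℝ) (μ₁ μ₂ : M) : ℝ :=
  dw μ₁ μ₂ + |∫ x, ψ x ∂((μ₁ : ProbabilityMeasure E) : Measure E)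
    - ∫ x, ψ x ∂((μ₂ : ProbabilityMeasure E) : Measure E)|

/-- `Θ₀` is locally uniformly `ψ`-integrating; `d` is a metric on `Θ₀` for the relative weak
topology. -/
def LocallyUniformlyIntegrating (ψ : E → ℝ) (Θ₀ : Set (ProbabilityMeasure E))
    (d : Θ₀ → Θ₀ → ℝ) : Prop :=
  ∀ μ₁ : Θ₀, ∀ ε > (0 : ℝ), ∃ δ > (0 : ℝ), ∃ a > (0 : ℝ), ∀ μ₂ : Θ₀, d μ₁ μ₂ ≤ δ →
    ∫⁻ x in {x | a ≤ ψ x}, ENNReal.ofReal (ψ x) ∂((μ₂ : ProbabilityMeasure E) : Measure E)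
      ≤ ENNReal.ofReal ε

variable {S : Type*} {Θ : Set (ProbabilityMeasure E)}

/-- The plug-in estimator as a map on `E ^ n`: it sends `(x₁, …, xₙ)` to the value of `T n` at the
empirical measure of `(x₁, …, xₙ)`. -/
def plugIn (T : ℕ+ → Θ → S) (hΘ : ∀ (n : ℕ+) (x : Fin n → E), empirical n x ∈ Θ)
    (n : ℕ+) (x : Fin n → E) : S :=
  T n ⟨empirical n x, hΘ n x⟩

/-- The plug-in estimator as a map on the sequence space; it only uses the first `n`
observations. -/
def plugInSeq (T : ℕ+ → Θ → S) (hΘ : ∀ (n : ℕ+) (x : Fin n → E), empirical n x ∈ Θ)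
    (n : ℕ+) (x : ℕ → E) : S :=
  plugIn T hΘ n fun i => x i

end Sample

end

end PlugIn

open scoped BoundedContinuousFunction

namespace PlugIn

/-! Assertion (i) rests on a uniform weak law of large numbers: as `μ → μ₁` within `Θ₀` and `n → ∞`
jointly, the empirical measure falls into any `dPsi`-neighbourhood of `μ₁` with probability tending
to one. For bounded test functions this is Chebyshev's inequality, whose bound does not depend on
`μ`; for `ψ` one truncates and controls the tail by Markov's inequality and local uniform
integrability. Asymptotic continuity then puts both estimator laws, up to mass `ε`, in one ball
around the deterministic point `T n μ₁`, which makes them Prohorov-close (`prohorov_le`). For (ii),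
each estimator law is a continuous image of an `n`-fold product measure, and products and images are
weakly continuous. For (iii), consistency turns the laws into Dirac masses in the limit, and
`diracProba` is an embedding. -/

theorem Metrizes.mem_nhds_iff {X : Type*} [TopologicalSpace X] {d : X → X → ℝ} (hd : Metrizes d)
    {x : X} {s : Set X} : s ∈ 𝓝 x ↔ ∃ ε > 0, ∀ y, d x y ≤ ε → y ∈ s := by
  constructor
  · intro hs
    obtain ⟨t, hts, ht, hxt⟩ := _root_.mem_nhds_iff.1 hs
    obtain ⟨ε, hε, h⟩ := (hd.isOpen_iff t).1 ht x hxt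
    -- Halving turns the strict inequality of `Metrizes` into the `≤` of the robustness definitions.
    exact ⟨ε / 2, half_pos hε, fun y hy => hts (h y (by linarith))⟩
  · rintro ⟨ε, hε, h⟩
    refine _root_.mem_nhds_iff.2 ⟨{y | d x y < ε}, fun y hy => h y (le_of_lt hy), ?_, ?_⟩
    · refine (hd.isOpen_iff _).2 fun y hy => ⟨ε - d x y, sub_pos.2 hy, fun z hz => ?_⟩
      have := hd.dist_triangle x y z
      simp only [Set.mem_ofPred_eq]
      linarith
    · simpa [hd.dist_self] using hε

/-- Sets which contain the values `X i` with probability tending to one along `F`. -/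
def probFilter {ι Ω Y : Type*} [MeasurableSpace Ω] (F : Filter ι) (P : ι → Measure Ω)
    (X : ι → Ω → Y) : Filter Y where
  sets := {U | Tendsto (fun i => P i {ω | X i ω ∉ U}) F (𝓝 0)}
  univ_sets := by simpa using tendsto_const_nhds
  sets_of_superset {U V} hU hUV :=
    tendsto_of_tendsto_of_tendsto_of_le_of_le tendsto_const_nhds hU (fun _ => zero_le)
      fun i => measure_mono fun _ hω h => hω (hUV h)
  inter_sets {U V} hU hV := by
    refine tendsto_of_tendsto_of_tendsto_of_le_of_le tendsto_const_nhds
      (by simpa using hU.add hV) (fun _ => zero_le) fun i => ?_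
    refine (measure_mono fun ω hω => ?_).trans (measure_union_le _ _)
    by_contra h
    simp only [Set.mem_union, Set.mem_ofPred_eq, not_or, not_not] at h
    exact hω h

theorem mem_probFilter {ι Ω Y : Type*} [MeasurableSpace Ω] {F : Filter ι} {P : ι → Measure Ω}
    {X : ι → Ω → Y} {U : Set Y} :
    U ∈ probFilter F P X ↔ Tendsto (fun i => P i {ω | X i ω ∉ U}) F (𝓝 0) := Iff.rfl

/-- If `A` meets the ball, its `ε`-thickening contains the whole ball, whose diameter is at most
`ε`; otherwise `A` lies in the complement, which is `μ₁`-small. -/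
theorem prohorov_le {S : Type*} [MetricSpace S] [MeasurableSpace S] [BorelSpace S]
    {μ₁ μ₂ : ProbabilityMeasure S} {s : S} {ε : ℝ} (hε : 0 < ε)
    (h₁ : (μ₁ : Measure S) (Metric.closedBall s (ε / 2))ᶜ ≤ ENNReal.ofReal ε)
    (h₂ : (μ₂ : Measure S) (Metric.closedBall s (ε / 2))ᶜ ≤ ENNReal.ofReal ε) :
    prohorov μ₁ μ₂ ≤ ε := by
  refine csInf_le ⟨0, fun x hx => hx.1.le⟩ ⟨hε, fun A _ => ?_⟩
  by_cases hA : ∃ a ∈ A, a ∈ Metric.closedBall s (ε / 2)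
  · obtain ⟨a, haA, has⟩ := hA
    have hsub : Metric.closedBall s (ε / 2) ⊆ Metric.cthickening ε A := fun y hy => by
      refine Metric.mem_cthickening_of_dist_le y a ε A haA ?_
      rw [Metric.mem_closedBall] at hy has
      linarith [dist_triangle_right y a s]
    calc (μ₁ : Measure S) A ≤ 1 := prob_le_one
      _ = (μ₂ : Measure S) (Metric.closedBall s (ε / 2))
          + (μ₂ : Measure S) (Metric.closedBall s (ε / 2))ᶜ :=
        (prob_add_prob_compl Metric.isClosed_closedBall.measurableSet).symm
      _ ≤ _ := add_le_add (measure_mono hsub) h₂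
  · push Not at hA
    exact ((measure_mono fun a ha => hA a ha).trans h₁).trans le_add_self

/-! ### Moment inequalities for empirical means -/

section Sample

variable {E : Type*} [MeasurableSpace E]

theorem iidLaw_map_restrict (μ : ProbabilityMeasure E) (n : ℕ) :
    (iidLaw μ : Measure (ℕ → E)).map (fun x (i : Fin n) => x i)
      = Measure.pi fun _ : Fin n => (μ : Measure E) := by
  have h := (ProbabilityTheory.iIndepFun_infinitePi
    (P := fun _ : ℕ => (μ : Measure E)) (X := fun _ x => x) fun _ => measurable_id).precomp
      (Fin.val_injective (n := n))
  rw [ProbabilityTheory.iIndepFun_iff_map_fun_eq_pi_map (fun i => (measurable_pi_apply _).aemeasurable)] at h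
  refine h.trans ?_
  congr 1
  ext1 i
  exact Measure.infinitePi_map_eval _ _

theorem integral_empirical {f : E → ℝ} (hf : StronglyMeasurable f) (n : ℕ+) (x : Fin n → E) :
    ∫ y, f y ∂(empirical n x : Measure E) = (n : ℝ)⁻¹ * ∑ i, f (x i) := by
  change ∫ y, f y ∂(((n : ℕ) : ℝ≥0∞)⁻¹ • ∑ i, Measure.dirac (x i)) = _
  rw [integral_smul_measure, integral_finsetSum_measure]
  · simp [integral_dirac' _ _ hf]
  · exact fun i _ => integrable_dirac' hf (by simp)

theorem integrable_empirical {f : E → ℝ} (hf : StronglyMeasurable f) (n : ℕ+) (x : Fin n → E) :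
    Integrable f (empirical n x : Measure E) := by
  have hn : ((n : ℕ) : ℝ≥0∞) ≠ 0 := by exact_mod_cast n.ne_zero
  exact (integrable_finsetSum_measure.2 fun i _ => integrable_dirac' hf (by simp)).smul_measure
    (ENNReal.inv_ne_top.2 hn)

theorem lintegral_empirical {f : E → ℝ≥0∞} (hf : Measurable f) (n : ℕ+) (x : Fin n → E) :
    ∫⁻ y, f y ∂(empirical n x : Measure E) = (n : ℝ≥0∞)⁻¹ * ∑ i, f (x i) := by
  change ∫⁻ y, f y ∂(((n : ℕ) : ℝ≥0∞)⁻¹ • ∑ i, Measure.dirac (x i)) = _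
  rw [lintegral_smul_measure, lintegral_finsetSum_measure]
  simp [lintegral_dirac' _ hf]

/-- Chebyshev's inequality for empirical means of bounded functions. -/
theorem iidLaw_le_of_bounded {f : E → ℝ} (hf : StronglyMeasurable f) {C : ℝ}
    (hC : ∀ x, |f x| ≤ C) (μ : ProbabilityMeasure E) (n : ℕ+) {c : ℝ} (hc : 0 < c) :
    (iidLaw μ : Measure (ℕ → E))
      {x | c ≤ |∫ y, f y ∂(empirical n (fun i => x i) : Measure E) - ∫ y, f y ∂(μ : Measure E)|}
      ≤ ENNReal.ofReal (C ^ 2 / c ^ 2 / n) := by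
  set P := (iidLaw μ : Measure (ℕ → E))
  have hfm := hf.measurable
  have hn : (0 : ℝ) < n := by exact_mod_cast n.pos
  let X : Fin n → (ℕ → E) → ℝ := fun i x => f (x i)
  have hXm : ∀ i, Measurable (X i) := fun i => by fun_prop
  have hX : ∀ i, MemLp (X i) 2 P := fun i =>
    MemLp.of_bound (hXm i).aestronglyMeasurable C (ae_of_all _ fun x => hC _)
  have hmp : ∀ i : ℕ, MeasurePreserving (fun x : ℕ → E => x i) P μ := fun i =>
    measurePreserving_eval_infinitePi (fun _ : ℕ => (μ : Measure E)) i
  have hmean : ∀ i, ∫ x, X i x ∂P = ∫ y, f y ∂(μ : Measure E) := fun i => by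
    rw [← (hmp i).map_eq, integral_map (measurable_pi_apply _).aemeasurable hf.aestronglyMeasurable]
  have hvar : ∀ i, ProbabilityTheory.variance (X i) P ≤ C ^ 2 := fun i => by
    refine (ProbabilityTheory.variance_le_sq_of_bounded (a := -C) (b := C)
      (ae_of_all _ fun x => abs_le.1 (hC _)) (hXm i).aemeasurable).trans (le_of_eq (by ring))
  have hind : ProbabilityTheory.iIndepFun X P :=
    (ProbabilityTheory.iIndepFun_infinitePi (P := fun _ : ℕ => (μ : Measure E))
      (X := fun _ => f) fun _ => hfm).precomp (Fin.val_injective (n := n))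
  have hsum : ProbabilityTheory.variance (∑ i, X i) P ≤ n * C ^ 2 := by
    rw [ProbabilityTheory.IndepFun.variance_sum (fun i _ => hX i)
      fun i _ j _ hij => hind.indepFun hij]
    refine (Finset.sum_le_sum fun i _ => hvar i).trans (by simp)
  -- A deviation `c` of the mean is a deviation `n * c` of the sum, whose variance is at most `n * C
  -- ^ 2`.
  have key := ProbabilityTheory.meas_ge_le_variance_div_sq (memLp_finsetSum' Finset.univ
    fun i _ => hX i) (mul_pos hn hc)
  refine (measure_mono ?_).trans (key.trans (ENNReal.ofReal_le_ofReal ?_))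
  · intro x hx
    simp only [Set.mem_ofPred_eq, Finset.sum_apply] at hx ⊢
    rw [integral_finsetSum _ fun i _ => (hX i).integrable (by norm_num)]
    simp only [hmean, Finset.sum_const, Finset.card_univ, Fintype.card_fin, nsmul_eq_mul]
    rw [integral_empirical hf] at hx
    calc (n : ℝ) * c ≤ n * _ := mul_le_mul_of_nonneg_left hx hn.le
      _ = _ := by
        rw [← abs_of_pos hn, ← abs_mul, abs_of_pos hn, mul_sub, mul_inv_cancel_left₀ hn.ne']
  · rw [div_div, div_le_div_iff₀ (by positivity) (by positivity)]
    have := mul_le_mul_of_nonneg_right hsum (show 0 ≤ c ^ 2 * (n : ℝ) by positivity)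
    linarith

/-- Markov's inequality for empirical means of nonnegative functions. -/
theorem iidLaw_le_of_lintegral {f : E → ℝ≥0∞} (hf : Measurable f) (μ : ProbabilityMeasure E)
    (n : ℕ+) {c : ℝ≥0∞} (hc : c ≠ 0) (hc' : c ≠ ∞) :
    (iidLaw μ : Measure (ℕ → E))
      {x | c ≤ ∫⁻ y, f y ∂(empirical n (fun i => x i) : Measure E)}
      ≤ (∫⁻ y, f y ∂(μ : Measure E)) / c := by
  simp only [lintegral_empirical hf]
  have hfi : ∀ i : ℕ, Measurable fun x : ℕ → E => f (x i) := fun i => by fun_prop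
  have hfs : Measurable fun x : ℕ → E => ∑ i : Fin n, f (x i) :=
    Finset.measurable_fun_sum _ fun i _ => hfi i
  refine (meas_ge_le_lintegral_div (hfs.const_mul _).aemeasurable hc hc').trans (le_of_eq ?_)
  congr 1
  have h : ∀ i : ℕ, ∫⁻ x, f (x i) ∂(iidLaw μ : Measure (ℕ → E)) = ∫⁻ y, f y ∂(μ : Measure E) :=
    fun i => (measurePreserving_eval_infinitePi (fun _ : ℕ => (μ : Measure E)) i).lintegral_comp hf
  have hn : ((n : ℕ) : ℝ≥0∞) ≠ 0 := by exact_mod_cast n.ne_zero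
  rw [lintegral_const_mul _ hfs,
    lintegral_finsetSum (f := fun (i : Fin n) (x : ℕ → E) => f (x i)) _ fun i _ => hfi i]
  simp [h, ← mul_assoc, ENNReal.inv_mul_cancel hn]

end Sample

/-! ### Uniform weak law of large numbers -/

section Sample

variable {E : Type*} [MetricSpace E] [MeasurableSpace E] [BorelSpace E]

/-- The sets which contain the empirical measures with probability tending to one as the sample
size grows, uniformly in the law near `μ₁` within `Θ₀`. -/
noncomputable def empiricalFilter (Θ₀ : Set (ProbabilityMeasure E)) (μ₁ : ProbabilityMeasure E) :
    Filter (ProbabilityMeasure E) :=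
  probFilter (𝓝[Θ₀] μ₁ ×ˢ (atTop : Filter ℕ+)) (fun p => (iidLaw p.1 : Measure (ℕ → E)))
    fun p x => empirical p.2 fun i => x i

variable {Θ₀ : Set (ProbabilityMeasure E)} {μ₁ : ProbabilityMeasure E}

/-- Half of `ε` pays for the random fluctuation around the mean under the current law, half for the
drift of that mean from its value at `μ₁`. -/
theorem tendsto_integral_empiricalFilter {f : E → ℝ} (hf : StronglyMeasurable f) {C : ℝ}
    (hC : ∀ x, |f x| ≤ C)
    (hlim : Tendsto (fun μ : ProbabilityMeasure E => ∫ y, f y ∂(μ : Measure E)) (𝓝[Θ₀] μ₁)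
      (𝓝 (∫ y, f y ∂(μ₁ : Measure E)))) :
    Tendsto (fun μ : ProbabilityMeasure E => ∫ y, f y ∂(μ : Measure E)) (empiricalFilter Θ₀ μ₁)
      (𝓝 (∫ y, f y ∂(μ₁ : Measure E))) := by
  refine Metric.tendsto_nhds.2 fun ε hε => mem_probFilter.2 ?_
  have hb : Tendsto (fun p : ProbabilityMeasure E × ℕ+ =>
      ENNReal.ofReal (C ^ 2 / (ε / 2) ^ 2 / p.2)) (𝓝[Θ₀] μ₁ ×ˢ atTop) (𝓝 0) := by
    have h1 : Tendsto (fun n : ℕ+ => (n : ℝ)) atTop atTop :=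
      tendsto_natCast_atTop_atTop.comp tendsto_PNat_val_atTop_atTop
    have h2 := ENNReal.tendsto_ofReal (h1.const_div_atTop (C ^ 2 / (ε / 2) ^ 2))
    rw [ENNReal.ofReal_zero] at h2
    exact h2.comp tendsto_snd
  refine tendsto_of_tendsto_of_tendsto_of_le_of_le' tendsto_const_nhds hb
    (Eventually.of_forall fun _ => zero_le) ?_
  filter_upwards [tendsto_fst.eventually (Metric.tendsto_nhds.1 hlim (ε / 2) (half_pos hε))]
    with p hp
  refine (measure_mono fun x hx => ?_).trans (iidLaw_le_of_bounded hf hC p.1 p.2 (half_pos hε))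
  simp only [Set.mem_ofPred_eq, not_lt, ← Real.dist_eq] at hx hp ⊢
  linarith [dist_triangle (∫ y, f y ∂(empirical p.2 (fun i => x i) : Measure E))
    (∫ y, f y ∂(p.1 : Measure E)) (∫ y, f y ∂(μ₁ : Measure E))]

theorem tendsto_boundedContinuousFunction_empiricalFilter (f : E →ᵇ ℝ) :
    Tendsto (fun μ : ProbabilityMeasure E => ∫ y, f y ∂(μ : Measure E)) (empiricalFilter Θ₀ μ₁)
      (𝓝 (∫ y, f y ∂(μ₁ : Measure E))) :=
  tendsto_integral_empiricalFilter f.continuous.measurable.stronglyMeasurable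
    (fun x => f.norm_coe_le_norm x)
    ((ProbabilityMeasure.tendsto_iff_forall_integral_tendsto.1 tendsto_id f).mono_left
      nhdsWithin_le_nhds)

/-- Uniform weak law of large numbers for the empirical measures. -/
theorem empiricalFilter_le_nhds : empiricalFilter Θ₀ μ₁ ≤ 𝓝 μ₁ :=
  -- Since `empiricalFilter` is a filter, it suffices to treat one test function at a time.
  tendsto_id'.1 (ProbabilityMeasure.tendsto_iff_forall_integral_tendsto.2
    tendsto_boundedContinuousFunction_empiricalFilter)

/-- The truncation error `ψ - min ψ a` vanishes off `{a ≤ ψ}` and is at most `ψ` on it. -/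
theorem abs_integral_sub_integral_min_le {ψ : E → ℝ} (hψ : Continuous ψ) (hψ_one : ∀ x, 1 ≤ ψ x)
    (μ : ProbabilityMeasure E) (hμ : Integrable ψ (μ : Measure E)) (a : ℝ) {e : ℝ} (he : 0 ≤ e)
    (h : ∫⁻ x in {x | a ≤ ψ x}, ENNReal.ofReal (ψ x) ∂(μ : Measure E) ≤ ENNReal.ofReal e)
    (ha : 0 < a) :
    |∫ x, ψ x ∂(μ : Measure E) - ∫ x, min (ψ x) a ∂(μ : Measure E)| ≤ e := by
  have hmin : Integrable (fun x => min (ψ x) a) (μ : Measure E) := hμ.inf (integrable_const a)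
  have hset : MeasurableSet {x | a ≤ ψ x} := measurableSet_le measurable_const hψ.measurable
  have hnn : 0 ≤ ∫ x, (ψ x - min (ψ x) a) ∂(μ : Measure E) :=
    integral_nonneg fun x => sub_nonneg.2 (min_le_left _ _)
  rw [← integral_sub hμ hmin, abs_of_nonneg hnn]
  refine (ENNReal.ofReal_le_ofReal_iff he).1 (le_trans ?_ h)
  rw [ofReal_integral_eq_lintegral_ofReal (f := fun x => ψ x - min (ψ x) a) (hμ.sub hmin)
    (ae_of_all _ fun x => sub_nonneg.2 (min_le_left _ _)), ← lintegral_indicator hset]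
  refine lintegral_mono fun x => ?_
  by_cases hx : x ∈ {x | a ≤ ψ x}
  · rw [Set.indicator_of_mem hx]
    refine ENNReal.ofReal_le_ofReal ?_
    have := hψ_one x
    rw [min_eq_right (show a ≤ ψ x from hx)]
    linarith
  · rw [Set.indicator_of_notMem hx, min_eq_left (le_of_not_ge hx)]
    simp

theorem tendsto_integral_psi_empiricalFilter {ψ : E → ℝ} (hψ : Continuous ψ)
    (hψ_one : ∀ x, 1 ≤ ψ x) (hμ₁ : Integrable ψ (μ₁ : Measure E)) (hmem : μ₁ ∈ Θ₀)
    (hlui : ∀ ε > (0 : ℝ), ∃ a > (0 : ℝ), ∀ᶠ μ : ProbabilityMeasure E in 𝓝[Θ₀] μ₁,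
      ∫⁻ x in {x | a ≤ ψ x}, ENNReal.ofReal (ψ x) ∂(μ : Measure E) ≤ ENNReal.ofReal ε) :
    Tendsto (fun μ : ProbabilityMeasure E => ∫ y, ψ y ∂(μ : Measure E)) (empiricalFilter Θ₀ μ₁)
      (𝓝 (∫ y, ψ y ∂(μ₁ : Measure E))) := by
  refine Metric.tendsto_nhds.2 fun ε hε => mem_probFilter.2 ?_
  refine ENNReal.tendsto_nhds_zero.2 fun η hη => ?_
  obtain ⟨r, hr0, hrη⟩ : ∃ r : ℝ, 0 < r ∧ ENNReal.ofReal r ≤ η / 2 := by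
    rcases eq_or_ne η ∞ with rfl | h
    · exact ⟨1, one_pos, by simp [ENNReal.top_div]⟩
    · refine ⟨(η / 2).toReal, ENNReal.toReal_pos (ENNReal.half_pos hη.ne').ne' ?_, ?_⟩
      · exact (ENNReal.div_lt_top h (by simp)).ne
      · exact ENNReal.ofReal_toReal_le
  have hε3 : 0 < ε / 3 := by positivity
  -- `ε / 4` bounds the truncation error at `μ₁`; `ε / 3 * r` makes Markov's bound at threshold `ε /
  -- 3` at most `r`. The errors add up to less than `ε / 4 + ε / 3 + ε / 3 < ε`.
  obtain ⟨a, ha, hev⟩ := hlui (min (ε / 4) (ε / 3 * r)) (by positivity)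
  have hmin : Continuous fun x => min (ψ x) a := hψ.min continuous_const
  have hset : MeasurableSet {x | a ≤ ψ x} := measurableSet_le measurable_const hψ.measurable
  have hbdd : ∀ x, |min (ψ x) a| ≤ a := fun x => by
    rw [abs_of_nonneg (le_min (zero_le_one.trans (hψ_one x)) ha.le)]
    exact min_le_right _ _
  let f : E →ᵇ ℝ := BoundedContinuousFunction.ofNormedAddCommGroup _ hmin a hbdd
  have hf := mem_probFilter.1 (Metric.tendsto_nhds.1
    (tendsto_boundedContinuousFunction_empiricalFilter (Θ₀ := Θ₀) (μ₁ := μ₁) f) (ε / 3) hε3)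
  have h₁ := abs_integral_sub_integral_min_le hψ hψ_one μ₁ hμ₁ a (by positivity)
    ((hev.self_of_nhdsWithin hmem).trans (ENNReal.ofReal_le_ofReal (min_le_left _ _))) ha
  filter_upwards [ENNReal.tendsto_nhds_zero.1 hf (η / 2) (ENNReal.half_pos hη.ne'),
    tendsto_fst.eventually hev] with p hp hpev
  have hsub : {x : ℕ → E | (empirical p.2 fun i => x i) ∉ {μ : ProbabilityMeasure E |
      dist (∫ y, ψ y ∂(μ : Measure E)) (∫ y, ψ y ∂(μ₁ : Measure E)) < ε}} ⊆
      {x | (empirical p.2 fun i => x i) ∉ {μ : ProbabilityMeasure E |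
        dist (∫ y, f y ∂(μ : Measure E)) (∫ y, f y ∂(μ₁ : Measure E)) < ε / 3}} ∪
      {x | ENNReal.ofReal (ε / 3) ≤ ∫⁻ y, Set.indicator {x | a ≤ ψ x}
        (fun x => ENNReal.ofReal (ψ x)) y ∂(empirical p.2 (fun i => x i) : Measure E)} := by
    intro x hx
    by_contra hcon
    simp only [Set.mem_union, not_or] at hcon
    obtain ⟨hc1, hc2⟩ := hcon
    simp only [Set.mem_ofPred_eq, not_le, not_lt] at hx hc1 hc2
    rw [lintegral_indicator hset] at hc2
    have h₂ := abs_integral_sub_integral_min_le hψ hψ_one (empirical p.2 fun i => x i)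
      (integrable_empirical hψ.measurable.stronglyMeasurable _ _) a hε3.le hc2.le ha
    have hc1' : |∫ y, min (ψ y) a ∂(empirical p.2 (fun i => x i) : Measure E)
      - ∫ y, min (ψ y) a ∂(μ₁ : Measure E)| < ε / 3 := hc1
    rw [Real.dist_eq] at hx
    rw [abs_le] at h₁ h₂
    rw [abs_lt] at hc1'
    refine absurd hx (not_le.2 (abs_lt.2 ⟨?_, ?_⟩)) <;> linarith [h₁.1, h₁.2, h₂.1, h₂.2]
  refine (measure_mono hsub).trans ((measure_union_le _ _).trans ?_)
  rw [← ENNReal.add_halves η]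
  refine add_le_add hp ((iidLaw_le_of_lintegral
    ((hψ.measurable.ennreal_ofReal).indicator hset) p.1 p.2
    (ENNReal.ofReal_pos.2 hε3).ne' ENNReal.ofReal_ne_top).trans (le_trans ?_ hrη))
  rw [lintegral_indicator hset]
  refine ENNReal.div_le_of_le_mul (hpev.trans ?_)
  rw [← ENNReal.ofReal_mul hr0.le]
  exact ENNReal.ofReal_le_ofReal ((min_le_right _ _).trans (le_of_eq (mul_comm _ _)))

end Sample

/-! ### Robustness of plug-in estimators -/

section Estimator

variable {E : Type*} [MeasurableSpace E]
  {S : Type*} [MetricSpace S] [MeasurableSpace S] [BorelSpace S]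
  {Θ : Set (ProbabilityMeasure E)} {T : ℕ+ → Θ → S}
  {hΘ : ∀ (n : ℕ+) (x : Fin n → E), empirical n x ∈ Θ}

theorem estLaw_compl_closedBall (hT : ∀ n, Measurable (plugInSeq T hΘ n)) (n : ℕ+) (μ : Θ) (s : S)
    (r : ℝ) :
    (estLaw (fun μ : Θ => iidLaw (μ : ProbabilityMeasure E)) (plugInSeq T hΘ) hT n μ : Measure S)
      (Metric.closedBall s r)ᶜ
      = (iidLaw (μ : ProbabilityMeasure E) : Measure (ℕ → E))
        {x | r < dist (T n ⟨empirical n fun i => x i, hΘ n _⟩) s} := by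
  rw [estLaw, ProbabilityMeasure.map_apply' _ _ Metric.isClosed_closedBall.measurableSet.compl]
  congr 1
  ext x
  simp [plugInSeq, plugIn]

variable [MetricSpace E] [BorelSpace E]

theorem asymptoticallyRobustOn_of_asymptoticallyContinuous {ψ : E → ℝ} (hψ : Continuous ψ)
    (hψ_one : ∀ x, 1 ≤ ψ x) (hΘ_psi : Θ ⊆ psiMeasures ψ)
    (hT : ∀ n, Measurable (plugInSeq T hΘ n))
    {dΘ : Θ → Θ → ℝ} (hdΘ : Metrizes dΘ) {dw : Θ → Θ → ℝ} (hdw : Metrizes dw)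
    (hcont : AsymptoticallyContinuous (dPsi ψ dw) T) {Θ₀ : Set (ProbabilityMeasure E)}
    {d₀ : Θ₀ → Θ₀ → ℝ} (hd₀ : Metrizes d₀) (hlui : LocallyUniformlyIntegrating ψ Θ₀ d₀) :
    AsymptoticallyRobustOn (fun μ : Θ => iidLaw (μ : ProbabilityMeasure E))
      (plugInSeq T hΘ) hT dΘ prohorov {μ : Θ | (μ : ProbabilityMeasure E) ∈ Θ₀} := by
  intro μ₁ hμ₁ ε hε
  obtain ⟨δ, hδ, n₁, hn₁⟩ := hcont μ₁ (ε / 2) (half_pos hε)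
  have hlui' : ∀ ε > (0 : ℝ), ∃ a > (0 : ℝ), ∀ᶠ μ : ProbabilityMeasure E in 𝓝[Θ₀] ↑μ₁,
      ∫⁻ x in {x | a ≤ ψ x}, ENNReal.ofReal (ψ x) ∂(μ : Measure E) ≤ ENNReal.ofReal ε := by
    intro ε hε
    obtain ⟨δ, hδ, a, ha, h⟩ := hlui ⟨μ₁, hμ₁⟩ ε hε
    refine ⟨a, ha, (eventually_nhds_subtype_iff Θ₀ ⟨μ₁, hμ₁⟩ _).1 ?_⟩
    exact hd₀.mem_nhds_iff.2 ⟨δ, hδ, h⟩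
  have hψlim := tendsto_integral_psi_empiricalFilter hψ hψ_one (hΘ_psi μ₁.2) hμ₁ hlui'
  have hweak : ∀ᶠ ν : ProbabilityMeasure E in 𝓝 ↑μ₁, ∀ h : ν ∈ Θ, dw μ₁ ⟨ν, h⟩ ≤ δ / 2 := by
    have h : ∀ᶠ ν : Θ in 𝓝 μ₁, dw μ₁ ν ≤ δ / 2 :=
      hdw.mem_nhds_iff.2 ⟨δ / 2, half_pos hδ, fun _ h => h⟩
    rw [nhds_subtype, eventually_comap] at h
    exact h.mono fun ν hν h => hν ⟨ν, h⟩ rfl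
  have hgood : ∀ᶠ ν in empiricalFilter Θ₀ ↑μ₁, ∀ h : ν ∈ Θ, dPsi ψ dw μ₁ ⟨ν, h⟩ ≤ δ := by
    filter_upwards [empiricalFilter_le_nhds hweak,
      Metric.tendsto_nhds.1 hψlim (δ / 2) (half_pos hδ)] with ν h₁ h₂ h
    have := h₁ h
    rw [dist_comm, Real.dist_eq] at h₂
    simp only [dPsi]
    linarith
  have hlim := (mem_probFilter.1 hgood).eventually
    (ge_mem_nhds (ENNReal.ofReal_pos.2 hε))
  -- A set in the product filter contains a rectangle, which separates the choice of `δ'` from that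
  -- of `n₀`.
  obtain ⟨p, hp, q, hq, hpq⟩ := eventually_prod_iff.1
    (hlim.and (tendsto_snd.eventually (eventually_ge_atTop n₁)))
  obtain ⟨n₀, hn₀⟩ := eventually_atTop.1 hq
  have hp' : ∀ᶠ ν : Θ in 𝓝 μ₁, (ν : ProbabilityMeasure E) ∈ Θ₀ → p ν := by
    rw [nhds_subtype]
    exact (eventually_nhdsWithin_iff.1 hp).comap _
  obtain ⟨δ', hδ', hball⟩ := hdΘ.mem_nhds_iff.1 hp'
  have key : ∀ n, n₀ ≤ n → ∀ μ : Θ, p μ →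
      (estLaw (fun μ : Θ => iidLaw (μ : ProbabilityMeasure E)) (plugInSeq T hΘ) hT n μ :
        Measure S) (Metric.closedBall (T n μ₁) (ε / 2))ᶜ ≤ ENNReal.ofReal ε := by
    intro n hn μ hμ
    obtain ⟨h₁, h₂⟩ := hpq hμ (hn₀ n hn)
    rw [estLaw_compl_closedBall]
    refine (measure_mono fun x hx hcon => ?_).trans h₁
    refine not_le.2 (show ε / 2 < dist _ (T n μ₁) from hx) ?_
    rw [dist_comm]
    exact hn₁ _ (hcon (hΘ n _)) n h₂
  refine ⟨δ', hδ', n₀, fun μ₂ hμ₂ hd n hn => prohorov_le hε (key n hn μ₁ ?_)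
    (key n hn μ₂ (hball μ₂ hd hμ₂))⟩
  -- The law `μ₁` itself satisfies `p`, since it belongs to `Θ₀`.
  exact hp.self_of_nhdsWithin hμ₁

variable [TopologicalSpace.SeparableSpace E]

theorem continuous_estLaw (hT : ∀ n, Measurable (plugInSeq T hΘ n)) {n : ℕ+}
    (hcont : Continuous (plugIn T hΘ n)) :
    Continuous (estLaw (fun μ : Θ => iidLaw (μ : ProbabilityMeasure E)) (plugInSeq T hΘ) hT n) := by
  -- Makes the product σ-field on `Fin n → E` contain all open sets, so that continuous maps on it
  -- are measurable.
  have : SecondCountableTopology E := UniformSpace.secondCountable_of_separable E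
  have h : estLaw (fun μ : Θ => iidLaw (μ : ProbabilityMeasure E)) (plugInSeq T hΘ) hT n
      = fun μ : Θ => (ProbabilityMeasure.pi fun _ : Fin n => (μ : ProbabilityMeasure E)).map
        hcont.measurable.aemeasurable := by
    funext μ
    refine Subtype.ext ?_
    change (iidLaw (μ : ProbabilityMeasure E) : Measure (ℕ → E)).map (plugInSeq T hΘ n)
      = (Measure.pi fun _ : Fin n => ((μ : ProbabilityMeasure E) : Measure E)).map (plugIn T hΘ n)
    rw [← iidLaw_map_restrict, Measure.map_map hcont.measurable (by fun_prop)]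
    rfl
  rw [h]
  exact (ProbabilityMeasure.continuous_map hcont).comp
    (ProbabilityMeasure.continuous_pi.comp (continuous_pi fun _ => continuous_subtype_val))

theorem finiteSampleRobustOn_of_continuous (hT : ∀ n, Measurable (plugInSeq T hΘ n))
    {dΘ : Θ → Θ → ℝ} (hdΘ : Metrizes dΘ)
    {ρ : ProbabilityMeasure S → ProbabilityMeasure S → ℝ} (hρ : Metrizes ρ)
    (hcont : ∀ n, Continuous (plugIn T hΘ n)) :
    FiniteSampleRobustOn (fun μ : Θ => iidLaw (μ : ProbabilityMeasure E))
      (plugInSeq T hΘ) hT dΘ ρ Set.univ := by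
  intro μ₁ _ ε hε n₀
  have h : ∀ᶠ μ₂ in 𝓝 μ₁, ∀ n ∈ Set.Iic n₀,
      ρ (estLaw (fun μ : Θ => iidLaw (μ : ProbabilityMeasure E)) (plugInSeq T hΘ) hT n μ₁)
        (estLaw (fun μ : Θ => iidLaw (μ : ProbabilityMeasure E)) (plugInSeq T hΘ) hT n μ₂) ≤ ε :=
    (eventually_all_finite (Set.finite_Iic n₀)).2 fun n _ =>
      (continuous_estLaw hT (hcont n)).continuousAt.eventually
        (hρ.mem_nhds_iff.2 ⟨ε, hε, fun _ h => h⟩)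
  obtain ⟨δ, hδ, hball⟩ := hdΘ.mem_nhds_iff.1 h
  exact ⟨δ, hδ, fun μ₂ _ hd n hn => hball μ₂ hd n hn⟩

end Estimator

/-! ### Robustness and consistency imply continuity of the limit -/

section Consistency

variable {Ω Θ S : Type*} [MeasurableSpace Ω] [MetricSpace S] [MeasurableSpace S] [BorelSpace S]

/-- Convergence in probability to a constant implies convergence in distribution, and the law of a
constant is a Dirac mass. -/
theorem tendsto_estLaw_diracProba {P : Θ → ProbabilityMeasure Ω} {That : ℕ+ → Ω → S}
    (hT : ∀ n, Measurable (That n)) {θ : Θ} {s : S}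
    (h : ∀ η > (0 : ℝ), Tendsto (fun n : ℕ+ => (P θ : Measure Ω) {x | η ≤ dist (That n x) s})
      atTop (𝓝 0)) :
    Tendsto (fun n => estLaw P That hT n θ) atTop (𝓝 (diracProba s)) := by
  have hm : TendstoInMeasure (P θ : Measure Ω) That atTop fun _ => s :=
    tendstoInMeasure_iff_dist.2 h
  have hd : diracProba s = (P θ).map (f := fun _ => s) aemeasurable_const :=
    Subtype.ext (by simp [diracProba])
  rw [hd]
  exact (hm.tendstoInDistribution fun n => (hT n).aemeasurable).tendsto

theorem continuousWrt_of_asymptoticallyRobustOn {P : Θ → ProbabilityMeasure Ω} {That : ℕ+ → Ω → S}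
    (hT : ∀ n, Measurable (That n)) {dΘ : Θ → Θ → ℝ}
    {ρ : ProbabilityMeasure S → ProbabilityMeasure S → ℝ} (hρ : Metrizes ρ) {Θ₀ : Set Θ}
    (hrob : AsymptoticallyRobustOn P That hT dΘ ρ Θ₀) (T₀ : Θ₀ → S)
    (hcons : ∀ η > (0 : ℝ), ∀ θ : Θ₀, Tendsto (fun n : ℕ+ => (P θ : Measure Ω)
      {x | η ≤ dist (That n x) (T₀ θ)}) atTop (𝓝 0)) :
    ContinuousWrt (fun θ₁ θ₂ : Θ₀ => dΘ θ₁ θ₂) T₀ := by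
  intro θ₁ ε hε
  have hemb : 𝓝 (T₀ θ₁) = comap diracProba (𝓝 (diracProba (T₀ θ₁))) :=
    isEmbedding_diracProba.isInducing.nhds_eq_comap _
  have hnhds := Metric.closedBall_mem_nhds (T₀ θ₁) hε
  rw [hemb] at hnhds
  obtain ⟨V, hV, hVsub⟩ := hnhds
  obtain ⟨κ, hκ, hκV⟩ := hρ.mem_nhds_iff.1 hV
  have hκ3 : 0 < κ / 3 := by positivity
  obtain ⟨δ, hδ, n₀, hrob'⟩ := hrob θ₁ θ₁.2 (κ / 3) hκ3
  refine ⟨δ, hδ, fun θ₂ hd => ?_⟩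
  have hev : ∀ θ : Θ₀, ∀ᶠ n in atTop,
      ρ (diracProba (T₀ θ)) (estLaw P That hT n θ) ≤ κ / 3 := fun θ =>
    (tendsto_estLaw_diracProba hT fun η hη => hcons η hη θ).eventually
      (hρ.mem_nhds_iff.2 ⟨κ / 3, hκ3, fun _ h => h⟩)
  -- This `n` may depend on `θ₂`, so pointwise consistency suffices; `δ` was fixed before and is
  -- uniform. The three legs of length `κ / 3` join the two Dirac masses.
  obtain ⟨n, ⟨h₁, h₂⟩, hn⟩ := (((hev θ₁).and (hev θ₂)).and (eventually_ge_atTop n₀)).exists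
  have h₃ := hrob' θ₂ θ₂.2 hd n hn
  have t₁ := hρ.dist_triangle (diracProba (T₀ θ₁)) (estLaw P That hT n θ₁) (diracProba (T₀ θ₂))
  have t₂ := hρ.dist_triangle (estLaw P That hT n θ₁) (estLaw P That hT n θ₂)
    (diracProba (T₀ θ₂))
  rw [hρ.dist_comm (estLaw P That hT n θ₂)] at t₂
  rw [dist_comm]
  exact hVsub (hκV _ (by linarith) : diracProba (T₀ θ₂) ∈ V)

end Consistency

end PlugIn

theorem mainTheorem5
    {E : Type*} [MetricSpace E] [CompleteSpace E] [TopologicalSpace.SeparableSpace E]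
    [MeasurableSpace E] [BorelSpace E]
    {S : Type*} [MetricSpace S] [CompleteSpace S] [TopologicalSpace.SeparableSpace S]
    [MeasurableSpace S] [BorelSpace S]
    (ψ : E → ℝ) (hψ : Continuous ψ) (hψ_one : ∀ x, 1 ≤ ψ x)
    (Θ : Set (ProbabilityMeasure E)) (hΘ_psi : Θ ⊆ PlugIn.psiMeasures ψ)
    (hΘ : ∀ (n : ℕ+) (x : Fin n → E), PlugIn.empirical n x ∈ Θ)
    (T : ℕ+ → Θ → S) (hT : ∀ n, Measurable (PlugIn.plugInSeq T hΘ n))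
    (dΘ : Θ → Θ → ℝ) (hdΘ : PlugIn.Metrizes dΘ)
    (dw : Θ → Θ → ℝ) (hdw : PlugIn.Metrizes dw)
    (ρ : ProbabilityMeasure S → ProbabilityMeasure S → ℝ) (hρ : PlugIn.Metrizes ρ) :
    (PlugIn.AsymptoticallyContinuous (PlugIn.dPsi ψ dw) T →
      ∀ Θ₀ : Set (ProbabilityMeasure E), Θ₀ ⊆ Θ →
        ∀ d₀ : Θ₀ → Θ₀ → ℝ, PlugIn.Metrizes d₀ → PlugIn.LocallyUniformlyIntegrating ψ Θ₀ d₀ →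
          PlugIn.AsymptoticallyRobustOn (fun μ : Θ => PlugIn.iidLaw (μ : ProbabilityMeasure E))
            (PlugIn.plugInSeq T hΘ) hT dΘ PlugIn.prohorov {μ : Θ | (μ : ProbabilityMeasure E) ∈ Θ₀})
    ∧ ((∀ n, Continuous (PlugIn.plugIn T hΘ n)) →
        PlugIn.FiniteSampleRobustOn (fun μ : Θ => PlugIn.iidLaw (μ : ProbabilityMeasure E))
          (PlugIn.plugInSeq T hΘ) hT dΘ ρ Set.univ)
    ∧ (∀ Θ₀ : Set Θ,
        PlugIn.AsymptoticallyRobustOn (fun μ : Θ => PlugIn.iidLaw (μ : ProbabilityMeasure E))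
          (PlugIn.plugInSeq T hΘ) hT dΘ ρ Θ₀ →
        ∀ T₀ : Θ₀ → S,
          (∀ η > (0 : ℝ), ∀ μ : Θ₀,
            Tendsto (fun n : ℕ+ => (PlugIn.iidLaw ((μ : Θ) : ProbabilityMeasure E) : Measure (ℕ → E))
              {x | η ≤ dist (PlugIn.plugInSeq T hΘ n x) (T₀ μ)}) atTop (𝓝 0)) →
          PlugIn.ContinuousWrt (fun μ₁ μ₂ : Θ₀ => dΘ μ₁ μ₂) T₀) := by
  refine ⟨fun hcont Θ₀ _ d₀ hd₀ hlui => ?_, fun hcont => ?_, fun Θ₀ hrob T₀ hcons => ?_⟩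
  · exact PlugIn.asymptoticallyRobustOn_of_asymptoticallyContinuous hψ hψ_one hΘ_psi hT hdΘ hdw
      hcont hd₀ hlui
  · exact PlugIn.finiteSampleRobustOn_of_continuous hT hdΘ hρ hcont
  · exact PlugIn.continuousWrt_of_asymptoticallyRobustOn hT hρ hrob T₀ hcons
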